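/- \textbf{Theorem.} There exists an analytic set $E\subseteq\mathbb{R}$ (which is, in particular, Lebesgue measurable and has the property of Baire, i.e. differs from some open set by a meager set) such that the set $$E'=\{(x,y)\in\mathbb{R}^2 : x+y\in E\}$$ is not in the $\sigma$-algebra on $\mathbb{R}^2$ generated by the rectangles $A\times B$ with $A\subseteq\mathbb{R}$ arbitrary and $B\subseteq\mathbb{R}$ Lebesgue measurable, and is also not in the $\sigma$-algebra on $\mathbb{R}^2$ generated by the rectangles $A\times B$ with $A\subseteq\mathbb{R}$ arbitrary and $B\subseteq\mathbb{R}$ having the property of Baire. -/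

import Mathlib

open MeasureTheory

/-- The set `E' = {(x, y) : x + y ∈ E}` in the plane. -/
def sumPreimage (E : Set ℝ) : Set (ℝ × ℝ) :=
  {p | p.1 + p.2 ∈ E}

/-- The σ-algebra on the plane generated by the rectangles `A × B` with `A ⊆ ℝ` arbitrary and
`B ⊆ ℝ` satisfying `P`. -/
abbrev rectangleSigmaAlgebra (P : Set ℝ → Prop) : MeasurableSpace (ℝ × ℝ) :=
  MeasurableSpace.generateFrom {R | ∃ A B : Set ℝ, P B ∧ R = A ×ˢ B}

/-- Lebesgue measurability: measurability for the completion of Lebesgue measure. -/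
def IsLebesgueMeasurable (B : Set ℝ) : Prop :=
  NullMeasurableSet B volume

/-- The property of Baire: the set differs from an open set by a meager set. -/
def HasBaireProperty (B : Set ℝ) : Prop :=
  ∃ G : Set ℝ, IsOpen G ∧ IsMeagre (symmDiff B G)

open Set Filter Topology Pointwise

/-! Generation of a set by rectangles uses only countably many sides `B`, each Borel off a null (or
meagre) set. One conull (or comeagre) `T` therefore makes every vertical section of the set Borel
relative to `T`. Take `E` to be a copy of a universal analytic set `U`, placed in a null compact set
by `(c, p) ↦ a(c) + b(p)`. Some translate `b + s` maps an uncountable Borel set `K` into `T`. The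
section of `E'` at `a(c) - s` then reads off `U_c` on `K`, so every `U_c ∩ K` would be Borel;
diagonalizing inside `K` refutes this. -/

/-- For a set in the rectangle `σ`-algebra, a single set `T ∈ l` makes all vertical sections agree
on `T` with Borel sets. -/
theorem exists_mem_forall_section_eq {l : Filter ℝ} [CountableInterFilter l] {P : Set ℝ → Prop}
    (hP : ∀ B, P B → ∃ D, MeasurableSet D ∧ B =ᶠ[l] D) {X : Set (ℝ × ℝ)}
    (hX : MeasurableSet[rectangleSigmaAlgebra P] X) :
    ∃ T ∈ l, ∀ x, ∃ D : Set ℝ, MeasurableSet D ∧ ∀ y ∈ T, (x, y) ∈ X ↔ y ∈ D := by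
  refine MeasurableSpace.generateFrom_induction _
    (fun X _ => ∃ T ∈ l, ∀ x, ∃ D : Set ℝ, MeasurableSet D ∧ ∀ y ∈ T, (x, y) ∈ X ↔ y ∈ D)
    ?_ ?_ ?_ ?_ X hX
  · rintro _ ⟨A, B, hB, rfl⟩ -
    obtain ⟨D, hD, hBD⟩ := hP B hB
    refine ⟨{y | y ∈ B ↔ y ∈ D}, eventuallyEq_set.1 hBD, fun x => ?_⟩
    by_cases hx : x ∈ A
    · exact ⟨D, hD, fun y hy => by simpa [hx] using hy⟩
    · exact ⟨∅, .empty, fun y _ => by simp [hx]⟩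
  · exact ⟨univ, univ_mem, fun x => ⟨∅, .empty, by simp⟩⟩
  · rintro X - ⟨T, hT, h⟩
    refine ⟨T, hT, fun x => ?_⟩
    obtain ⟨D, hD, hDX⟩ := h x
    exact ⟨Dᶜ, hD.compl, fun y hy => not_congr (hDX y hy)⟩
  · intro s _ h
    choose T hT D hD hDs using h
    refine ⟨⋂ n, T n, countable_iInter_mem.2 hT, fun x => ⟨⋃ n, D n x,
      MeasurableSet.iUnion fun n => hD n x, fun y hy => ?_⟩⟩
    simp only [mem_iUnion]
    exact exists_congr fun n => hDs n x y (mem_iInter.1 hy n)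

/-! ### Universal analytic sets and diagonalization -/

instance polishSpace_cantor : PolishSpace (ℕ → Bool) := by
  have : TopologicalSpace.IsCompletelyMetrizableSpace (ℕ → Bool) := inferInstance
  have : TopologicalSpace.SeparableSpace (ℕ → Bool) := inferInstance
  infer_instance

instance polishSpace_cantor_prod_baire : PolishSpace ((ℕ → Bool) × (ℕ → ℕ)) := by
  have : TopologicalSpace.IsCompletelyMetrizableSpace (ℕ → Bool) := inferInstance
  have : TopologicalSpace.IsCompletelyMetrizableSpace (ℕ → ℕ) := inferInstance
  have : TopologicalSpace.SeparableSpace (ℕ → Bool) := inferInstance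
  have : TopologicalSpace.SeparableSpace (ℕ → ℕ) := inferInstance
  infer_instance

/-- The preimage of an analytic set under a Borel map is analytic. -/
theorem analyticSet_preimage_of_measurable {X Y : Type*} [t : TopologicalSpace X] [PolishSpace X]
    [MeasurableSpace X] [BorelSpace X] [TopologicalSpace Y] [T2Space Y]
    [SecondCountableTopology Y] [MeasurableSpace Y] [OpensMeasurableSpace Y] {s : Set Y}
    (hs : AnalyticSet s) {f : X → Y} (hf : Measurable f) : AnalyticSet (f ⁻¹' s) := by
  obtain ⟨t', ht', hft', hpol⟩ := hf.exists_continuous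
  have h := @AnalyticSet.preimage X Y t' _ hpol _ s hs f hft'
  have h' := @AnalyticSet.image_of_continuous X t' X t _ h id (continuous_id_of_le ht')
  rwa [image_id] at h'

/-- There is an analytic set in the square of the Cantor space whose sections are exactly the
analytic sets. -/
theorem exists_universal_analyticSet :
    ∃ U : Set ((ℕ → Bool) × (ℕ → Bool)), AnalyticSet U ∧
      ∀ A : Set (ℕ → Bool), AnalyticSet A → ∃ c, ∀ p, (c, p) ∈ U ↔ p ∈ A := by
  obtain ⟨V, hV⟩ : ∃ V : ℕ → Set ((ℕ → Bool) × (ℕ → ℕ)), TopologicalSpace.IsTopologicalBasis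
      (range V) := by
    obtain ⟨b, hbc, -, hb⟩ :=
      TopologicalSpace.exists_countable_basis ((ℕ → Bool) × (ℕ → ℕ))
    have hne : b.Nonempty := by
      rw [nonempty_iff_ne_empty]
      rintro rfl
      have h := hb.sUnion_eq
      rw [sUnion_empty] at h
      exact empty_ne_univ h
    obtain ⟨V, rfl⟩ := hbc.exists_eq_range hne
    exact ⟨V, hb⟩
  -- A code lists basic open sets to be avoided, so the sections of `W` are exactly the closed sets;
  -- projecting them gives all analytic sets.
  let W : Set ((ℕ → Bool) × ((ℕ → Bool) × (ℕ → ℕ))) :=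
    ⋂ n : ℕ, {w | w.1 n = true → w.2 ∉ V n}
  have hW : IsClosed W := by
    refine isClosed_iInter fun n => ?_
    have : {w : (ℕ → Bool) × ((ℕ → Bool) × (ℕ → ℕ)) | w.1 n = true → w.2 ∉ V n} =
        ((fun w : (ℕ → Bool) × ((ℕ → Bool) × (ℕ → ℕ)) => w.1 n) ⁻¹' {true} ∩ Prod.snd ⁻¹' V n)ᶜ := by
      ext w; simp
    rw [this, isClosed_compl_iff]
    refine IsOpen.inter ?_ ((hV.isOpen ⟨n, rfl⟩).preimage continuous_snd)
    exact (isOpen_discrete ({true} : Set Bool)).preimage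
      ((continuous_apply n).comp continuous_fst)
  refine ⟨(fun w => (w.1, w.2.1)) '' W, hW.analyticSet.image_of_continuous (by fun_prop), ?_⟩
  intro A hA
  obtain ⟨F, hF, hFA⟩ : ∃ F : Set ((ℕ → Bool) × (ℕ → ℕ)), IsClosed F ∧
      ∀ p, p ∈ A ↔ ∃ z, (p, z) ∈ F := by
    rw [AnalyticSet] at hA
    rcases hA with rfl | ⟨f, hf, rfl⟩
    · exact ⟨∅, isClosed_empty, by simp⟩
    · exact ⟨{q | f q.2 = q.1}, isClosed_eq (by fun_prop) (by fun_prop), fun p => by simp⟩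
  classical
  refine ⟨fun n => decide (Disjoint (V n) F), fun p => ?_⟩
  have key : ∀ q, ((fun n => decide (Disjoint (V n) F)), q) ∈ W ↔ q ∈ F := by
    intro q
    simp only [W, mem_iInter, mem_ofPred_eq, decide_eq_true_eq]
    constructor
    · intro h
      by_contra hq
      obtain ⟨_, ⟨n, rfl⟩, hn, hsub⟩ := hV.exists_subset_of_mem_open
        (show q ∈ Fᶜ from hq) hF.isOpen_compl
      exact h n (disjoint_left.2 fun x hx => hsub hx) hn
    · exact fun hq n hn hqn => disjoint_left.1 hn hqn hq
  rw [hFA]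
  constructor
  · rintro ⟨⟨c, q⟩, hw, heq⟩
    simp only [Prod.mk.injEq] at heq
    obtain ⟨rfl, rfl⟩ := heq
    exact ⟨q.2, (key q).1 hw⟩
  · rintro ⟨z, hz⟩
    exact ⟨(_, (p, z)), (key _).2 hz, rfl⟩

/-- On every uncountable Borel set, some section of a universal analytic set is not Borel. -/
theorem exists_not_measurableSet_inter_section {U : Set ((ℕ → Bool) × (ℕ → Bool))}
    (hU : AnalyticSet U)
    (huniv : ∀ A : Set (ℕ → Bool), AnalyticSet A → ∃ c, ∀ p, (c, p) ∈ U ↔ p ∈ A)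
    {K : Set (ℕ → Bool)} (hK : MeasurableSet K) (hKc : ¬ K.Countable) :
    ∃ c, ¬ MeasurableSet (K ∩ {p | (c, p) ∈ U}) := by
  by_contra! hmeas
  have := hK.standardBorel
  have hC : ¬ Countable (ℕ → Bool) := fun h => hKc (to_countable K)
  let g : (ℕ → Bool) ≃ᵐ K := PolishSpace.measurableEquivOfNotCountable hC
    (fun h => hKc (countable_coe_iff.1 h))
  obtain ⟨k, hk, hkg⟩ := (MeasurableEmbedding.subtype_coe hK).exists_measurable_extend
    g.symm.measurable (fun _ => inferInstance)
  -- Since `k` inverts `g`, this is the diagonal set relative to `K`. If `d` codes its complement in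
  -- `K`, the point `g d` gives the contradiction.
  have hA : AnalyticSet ((fun p => (k p, p)) ⁻¹' U) :=
    analyticSet_preimage_of_measurable hU (hk.prodMk measurable_id)
  obtain ⟨c, hc⟩ := huniv _ hA
  have hB : MeasurableSet (K \ {p | (c, p) ∈ U}) := by
    rw [← sdiff_self_inter]
    exact hK.diff (hmeas c)
  obtain ⟨d, hd⟩ := huniv _ hB.analyticSet
  have h1 : k (g d) = d := by simpa using congrFun hkg (g d)
  have h2 := hd (g d)
  have h3 := hc (g d)
  simp only [mem_preimage, h1] at h3
  simp only [Set.mem_sdiff, mem_ofPred_eq, Subtype.coe_prop, true_and, h3] at h2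
  tauto

/-! ### A null Cantor set coding pairs -/

theorem continuous_cantorFunction {c : ℝ} (h0 : 0 ≤ c) (h1 : c < 1) :
    Continuous (Cardinal.cantorFunction c) := by
  refine continuous_tsum (u := fun n => c ^ n) (fun n => ?_)
    (summable_geometric_of_lt_one h0 h1) fun n f => ?_
  · exact (continuous_of_discreteTopology (f := fun b : Bool => cond b (c ^ n) 0)).comp
      (continuous_apply n)
  · cases h : f n <;> simp [h, abs_of_nonneg h0, h0]

/-- By self-similarity two translates of `c • S` cover `S`, so its finite measure `v` satisfies `v ≤
2cv` with `2c < 1`. -/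
theorem volume_range_cantorFunction {c : ℝ} (h0 : 0 ≤ c) (h2 : c < 1 / 2) :
    volume (range (Cardinal.cantorFunction c)) = 0 := by
  have h1 : c < 1 := by linarith
  set S := range (Cardinal.cantorFunction c) with hS
  have hfin : volume S ≠ ⊤ :=
    (isCompact_range (continuous_cantorFunction h0 h1)).measure_lt_top.ne
  have hsub : S ⊆ (c • S) ∪ ((1 : ℝ) +ᵥ (c • S)) := by
    rintro _ ⟨f, rfl⟩
    have hmem : c * Cardinal.cantorFunction c (fun n => f (n + 1)) ∈ c • S :=
      smul_mem_smul_set ⟨_, rfl⟩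
    rw [Cardinal.cantorFunction_succ f h0 h1]
    cases f 0
    · left; simpa using hmem
    · right; exact vadd_mem_vadd_set hmem
  have hle := (measure_mono hsub).trans (measure_union_le (μ := volume) _ _)
  rw [measure_vadd, Measure.addHaar_smul] at hle
  simp only [Module.finrank_self, pow_one, abs_of_nonneg h0] at hle
  lift volume S to NNReal using hfin with v
  rw [← ENNReal.ofReal_coe_nnreal, ← ENNReal.ofReal_mul h0,
    ← ENNReal.ofReal_add (by positivity) (by positivity),
    ENNReal.ofReal_le_ofReal_iff (by positivity)] at hle
  rw [ENNReal.coe_eq_zero, ← NNReal.coe_eq_zero]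
  nlinarith [v.coe_nonneg]

theorem cantorFunction_interleave {c : ℝ} (h0 : 0 ≤ c) (h1 : c < 1) (f : ℕ → Bool) :
    Cardinal.cantorFunction c f = Cardinal.cantorFunction (c ^ 2) (fun n => f (2 * n)) +
      c * Cardinal.cantorFunction (c ^ 2) (fun n => f (2 * n + 1)) := by
  have hs := Cardinal.summable_cantor_function f h0 h1
  rw [Cardinal.cantorFunction, ← tsum_even_add_odd
    (hs.comp_injective fun a b h => by simpa using h)
    (hs.comp_injective fun a b h => by simpa using h)]
  simp only [Cardinal.cantorFunction, Cardinal.cantorFunctionAux]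
  rw [← tsum_mul_left]
  congr 1 <;> refine tsum_congr fun n => ?_
  · rw [pow_mul]
  · cases f (2 * n + 1) <;> simp [pow_succ, pow_mul, mul_comm, mul_pow]

/-- The parametrization of a Cantor set by the sums `∑ aₙ 9⁻ⁿ + 3⁻¹ ∑ bₙ 9⁻ⁿ`. -/
noncomputable def cantorPairing (q : (ℕ → Bool) × (ℕ → Bool)) : ℝ :=
  Cardinal.cantorFunction ((1 / 3) ^ 2) q.1 + 1 / 3 * Cardinal.cantorFunction ((1 / 3) ^ 2) q.2

theorem continuous_cantorPairing : Continuous cantorPairing := by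
  have := continuous_cantorFunction (c := (1 / 3) ^ 2) (by norm_num) (by norm_num)
  unfold cantorPairing
  fun_prop

theorem cantorPairing_injective : Function.Injective cantorPairing := by
  have hinj : Function.Injective (Cardinal.cantorFunction ((1 / 3) ^ 2)) :=
    Cardinal.cantorFunction_injective (by norm_num) (by norm_num)
  let i (q : (ℕ → Bool) × (ℕ → Bool)) (n : ℕ) : Bool := if Even n then q.1 (n / 2) else q.2 (n / 2)
  have hi0 : ∀ q n, i q (2 * n) = q.1 n := fun q n => by simp [i]
  have hi1 : ∀ q n, i q (2 * n + 1) = q.2 n := fun q n => by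
    simp [i, show (2 * n + 1) / 2 = n by omega]
  have hi : ∀ q, cantorPairing q = Cardinal.cantorFunction (1 / 3) (i q) := fun q => by
    rw [cantorFunction_interleave (by norm_num) (by norm_num)]
    simp only [hi0, hi1, cantorPairing]
  intro q r h
  rw [hi, hi] at h
  have h' := Cardinal.cantorFunction_injective (by norm_num) (by norm_num) h
  ext n
  · rw [← hi0 q, ← hi0 r, h']
  · rw [← hi1 q, ← hi1 r, h']

theorem range_cantorPairing_subset :
    range cantorPairing ⊆ range (Cardinal.cantorFunction (1 / 3)) := by
  rintro _ ⟨q, rfl⟩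
  refine ⟨fun n => if Even n then q.1 (n / 2) else q.2 (n / 2), ?_⟩
  rw [cantorFunction_interleave (by norm_num) (by norm_num)]
  simp [cantorPairing, show ∀ n, (2 * n + 1) / 2 = n by omega]

/-! ### Translating a Cantor set into a large set -/

/-- Every conull set contains a translate of an uncountable Borel part of a parametrized set. -/
theorem exists_uncountable_add_mem_of_mem_ae {b : (ℕ → Bool) → ℝ} (hb : Measurable b)
    {T : Set ℝ} (hT : T ∈ ae (volume : Measure ℝ)) :
    ∃ s : ℝ, ∃ K : Set (ℕ → Bool), MeasurableSet K ∧ ¬ K.Countable ∧ ∀ p ∈ K, b p + s ∈ T := by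
  obtain ⟨Z, hZT, hZ, hZ0⟩ := exists_measurable_superset_of_null (mem_ae_iff.1 hT)
  have hR : ¬ Countable ℝ := fun h => Cardinal.not_countable_real (countable_univ_iff.2 h)
  have hC : ¬ Countable (ℕ → Bool) := by
    rw [← Cardinal.mk_le_aleph0_iff]
    simp [Cardinal.aleph0_lt_continuum]
  let e : ℝ ≃ᵐ (ℕ → Bool) := PolishSpace.measurableEquivOfNotCountable hR hC
  have hmeas : MeasurableSet {x : ℝ × ℝ | b (e x.1) + x.2 ∉ Z} :=
    (((hb.comp (e.measurable.comp measurable_fst)).add measurable_snd) hZ).compl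
  -- Fubini, with Lebesgue measure transported to the Cantor space by `e`: some `s` works for almost
  -- every `r`, hence for uncountably many points.
  have hae : ∀ᵐ r : ℝ, ∀ᵐ s : ℝ, b (e r) + s ∉ Z := by
    refine Eventually.of_forall fun r => ?_
    have : volume ((fun s => b (e r) + s) ⁻¹' Z) = 0 := by rwa [measure_preimage_add]
    exact measure_eq_zero_iff_ae_notMem.1 this
  obtain ⟨s, hs⟩ := ((Measure.ae_ae_comm hmeas).1 hae).exists
  refine ⟨s, {p | b p + s ∉ Z}, ((hb.add_const s) hZ).compl, fun hcount => ?_,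
    fun p hp => by_contra fun h => hp (hZT h)⟩
  have h1 : volume (e ⁻¹' {p | b p + s ∉ Z}) = 0 :=
    (hcount.preimage e.injective).measure_zero _
  have h2 : volume (univ : Set ℝ) = 0 := by
    rw [← union_compl_self (e ⁻¹' {p | b p + s ∉ Z})]
    exact measure_union_null h1 hs
  simp at h2

theorem isMeagre_singleton_cantor (p : ℕ → Bool) : IsMeagre ({p} : Set (ℕ → Bool)) := by
  refine residual_of_dense_open isOpen_compl_singleton fun x => ?_
  by_cases hx : x = p
  · subst hx
    have hlim : Tendsto (fun n => Function.update x n (!x n)) atTop (𝓝 x) := by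
      refine tendsto_pi_nhds.2 fun k => tendsto_const_nhds.congr' ?_
      filter_upwards [eventually_gt_atTop k] with n hn
      rw [Function.update_of_ne hn.ne]
    refine mem_closure_of_tendsto hlim (Eventually.of_forall fun n h => ?_)
    simpa using congrFun h n
  · exact subset_closure hx

/-- Every comeagre set contains a translate of an uncountable Borel part of a parametrized set. -/
theorem exists_uncountable_add_mem_of_mem_residual {b : (ℕ → Bool) → ℝ} (hb : Continuous b)
    {T : Set ℝ} (hT : T ∈ residual ℝ) :
    ∃ s : ℝ, ∃ K : Set (ℕ → Bool), MeasurableSet K ∧ ¬ K.Countable ∧ ∀ p ∈ K, b p + s ∈ T := by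
  obtain ⟨t, htT, ht, htd⟩ := mem_residual.1 hT
  let d := TopologicalSpace.denseSeq (ℕ → Bool)
  -- Generic `s` works for a countable dense set of `p`; the good `p` then form a dense Gδ, which is
  -- uncountable as points are meagre.
  have hres : ∀ n, {s : ℝ | b (d n) + s ∈ t} ∈ residual ℝ := fun n =>
    residual_of_dense_Gδ (ht.preimage (continuous_const_add (b (d n))))
      (htd.preimage (isOpenMap_add_left (b (d n))))
  obtain ⟨s, hs⟩ := (dense_of_mem_residual (countable_iInter_mem.2 hres)).nonempty
  have hK : IsGδ {p | b p + s ∈ t} := ht.preimage (hb.add continuous_const)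
  refine ⟨s, {p | b p + s ∈ t}, hK.measurableSet, fun hcount => ?_, fun p hp => htT hp⟩
  have hd : Dense {p | b p + s ∈ t} := (TopologicalSpace.denseRange_denseSeq _).mono <| by
    rintro _ ⟨n, rfl⟩
    exact mem_iInter.1 hs n
  refine not_isMeagre_of_isGδ_of_dense hK hd ?_
  rw [← biUnion_of_singleton {p | b p + s ∈ t}]
  exact isMeagre_biUnion hcount fun p _ => isMeagre_singleton_cantor p

/-- The image under `cantorPairing` of a universal analytic set has a sum preimage outside the
`σ`-algebra of rectangles whose vertical sides are Borel modulo a translation-rich filter. -/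
theorem not_measurableSet_sumPreimage_image {l : Filter ℝ} [CountableInterFilter l]
    {P : Set ℝ → Prop} (hP : ∀ B, P B → ∃ D, MeasurableSet D ∧ B =ᶠ[l] D)
    (hl : ∀ b : (ℕ → Bool) → ℝ, Continuous b → ∀ T ∈ l, ∃ s : ℝ, ∃ K : Set (ℕ → Bool),
      MeasurableSet K ∧ ¬ K.Countable ∧ ∀ p ∈ K, b p + s ∈ T)
    {U : Set ((ℕ → Bool) × (ℕ → Bool))} (hU : AnalyticSet U)
    (huniv : ∀ A : Set (ℕ → Bool), AnalyticSet A → ∃ c, ∀ p, (c, p) ∈ U ↔ p ∈ A) :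
    ¬ MeasurableSet[rectangleSigmaAlgebra P] (sumPreimage (cantorPairing '' U)) := by
  intro hX
  obtain ⟨T, hT, hsec⟩ := exists_mem_forall_section_eq hP hX
  have hf : Continuous (Cardinal.cantorFunction ((1 / 3) ^ 2)) :=
    continuous_cantorFunction (by norm_num) (by norm_num)
  have hb : Continuous fun p => 1 / 3 * Cardinal.cantorFunction ((1 / 3) ^ 2) p := by fun_prop
  obtain ⟨s, K, hK, hKc, hKT⟩ := hl _ hb T hT
  obtain ⟨c, hc⟩ := exists_not_measurableSet_inter_section hU huniv hK hKc
  -- The shift by `-s` cancels the translation: adding `b p + s` gives `cantorPairing (c, p)`.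
  obtain ⟨D, hD, hDT⟩ := hsec (Cardinal.cantorFunction ((1 / 3) ^ 2) c - s)
  refine hc ?_
  have heq : K ∩ {p | (c, p) ∈ U} =
      K ∩ (fun p => 1 / 3 * Cardinal.cantorFunction ((1 / 3) ^ 2) p + s) ⁻¹' D := by
    ext p
    refine and_congr_right fun hp => ?_
    rw [mem_preimage, ← hDT _ (hKT p hp), sumPreimage, mem_ofPred_eq, mem_ofPred_eq,
      ← cantorPairing_injective.mem_set_image, cantorPairing]
    ring_nf
  rw [heq]
  exact hK.inter ((hb.add continuous_const).measurable hD)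

theorem mainTheorem3 :
    ∃ E : Set ℝ, AnalyticSet E ∧
      IsLebesgueMeasurable E ∧
      HasBaireProperty E ∧
      ¬ MeasurableSet[rectangleSigmaAlgebra IsLebesgueMeasurable] (sumPreimage E) ∧
      ¬ MeasurableSet[rectangleSigmaAlgebra HasBaireProperty] (sumPreimage E) := by
  obtain ⟨U, hU, huniv⟩ := exists_universal_analyticSet
  have hsub : cantorPairing '' U ⊆ range (Cardinal.cantorFunction (1 / 3)) :=
    (image_subset_range _ _).trans range_cantorPairing_subset
  have hnull := volume_range_cantorFunction (c := 1 / 3) (by norm_num) (by norm_num)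
  have hcompact := isCompact_range
    (continuous_cantorFunction (c := 1 / 3) (by norm_num) (by norm_num))
  refine ⟨cantorPairing '' U, hU.image_of_continuous continuous_cantorPairing,
    NullMeasurableSet.of_null (measure_mono_null hsub hnull), ⟨∅, isOpen_empty, ?_⟩,
    not_measurableSet_sumPreimage_image (l := ae volume) (fun B hB => ?_)
      (fun b hb T hT => exists_uncountable_add_mem_of_mem_ae hb.measurable hT) hU huniv,
    not_measurableSet_sumPreimage_image (l := residual ℝ) (fun B hB => ?_)
      (fun b hb T hT => exists_uncountable_add_mem_of_mem_residual hb hT) hU huniv⟩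
  · rw [← bot_eq_empty, symmDiff_bot]
    exact (IsMeagre.of_isSigmaCompact_null hcompact.isSigmaCompact hnull).mono hsub
  · exact hB
  · obtain ⟨G, hG, hBG⟩ := hB
    refine ⟨G, hG.measurableSet, ?_⟩
    filter_upwards [hBG] with x hx
    simp only [mem_compl_iff, mem_symmDiff] at hx
    exact propext (by tauto)
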